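/- Let $\mathcal N=\{1,\dots,n\}$ be a set of products, $g:\mathcal N\to\{1,\dots,K\}$ a map assigning to each product its group, $\mathcal S$ a collection of subsets (assortments) of $\mathcal N$, and $\mathcal I_{\mathcal S}=\{(i,S): S\in\mathcal S,\ i\in S\}$. Let $\boldsymbol p_{\mathcal S}=(p_{i,S})_{(i,S)\in\mathcal I_{\mathcal S}}$ be a choice probability collection, i.e. $p_{i,S}\ge 0$ and $\sum_{i\in S}p_{i,S}=1$ for every $S\in\mathcal S$. For probability laws $F_1,\dots,F_n$ on $\mathbb R$ let $\Theta(F)$ be the set of joint laws of $\boldsymbol\epsilon=(\epsilon_1,\dots,\epsilon_n)$ with marginals $F_1,\dots,F_n$. The collection $\boldsymbol p_{\mathcal S}$ is representable by a grouped marginal distribution model (G-MDM) with grouping $g$ if there are $\boldsymbol\mu\in\mathbb R^n$ and laws $F_1,\dots,F_n$, each absolutely continuous, with finite first absolute moment and with a distribution function that is strictly increasing on its support, and with $F_i=\hat F_{g(i)}$ for laws $\hat F_1,\dots,\hat F_K$ attached to the groups, such that for every $S\in\mathcal S$ there is $\theta^*\in\Theta(F)$ attaining $\sup_{\theta\in\Theta(F)}\mathbb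 E_{\boldsymbol\epsilon\sim\theta}\big[\max_{i\in S}(\mu_i+\epsilon_i)\big]$ with $p_{i,S}=\mathbb P_{\boldsymbol\epsilon\sim\theta^*}\big(i=\arg\max_{j\in S}(\mu_j+\epsilon_j)\big)$ for all $i\in S$. Then $\boldsymbol p_{\mathcal S}$ is representable by a G-MDM with grouping $g$ if and only if there exist $\lambda:\mathcal S\to\mathbb R$ and $\boldsymbol\nu\in\mathbb R^n$ such that for all $(i,S),(j,T)\in\mathcal I_{\mathcal S}$ with $g(i)=g(j)$: $$\lambda(S)-\nu_i>\lambda(T)-\nu_j\ \text{ if } p_{i,S}<p_{j,T},\qquad \lambda(S)-\nu_i=\lambda(T)-\nu_j\ \text{ if } p_{i,S}=p_{j,T}\neq 0.$$ The class of representable collections is the same if the laws $\hat F_1,\dots,\hat F_K$ are moreover required to be pairwise distinct. Consequently, representability can be checked by a linear program: $\boldsymbol p_{\mathcal S}$ is representable if and only if the optimal value (in $[-\infty,+\infty]$) of the program that maximizes $\varepsilon$ over $(\lambda_S)_{S\in\mathcal S}$, $(\nu_i)_{i\in\mathcal N}$ and $\varepsilon$, subject for all $(i,S),(j,T)\in\mathcal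 I_{\mathcal S}$ with $g(i)=g(j)$ to $(\lambda_S-\nu_i)-(\lambda_T-\nu_j)-\varepsilon\ge 0$ if $p_{i,S}<p_{j,T}$ and $(\lambda_S-\nu_i)-(\lambda_T-\nu_j)=0$ if $p_{i,S}=p_{j,T}\ne0$, is strictly positive. This program has $O(n|\mathcal S|)$ variables (at most $3n|\mathcal S|$, when $\mathcal S\neq\emptyset$) and $O(n^2|\mathcal S|^2)$ constraints (at most $n^2|\mathcal S|^2$). -/

import Mathlib

open MeasureTheory ProbabilityTheory

namespace ChoiceModel

/-- The index set of all product-assortment pairs `(i, S)` with `S ∈ 𝒮` and `i ∈ S`;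
the products are the elements of `Fin n` and `𝒮` is the collection of observed assortments. -/
abbrev Pairs {n : ℕ} (𝒮 : Finset (Finset (Fin n))) : Type :=
  (S : {S : Finset (Fin n) // S ∈ 𝒮}) × {i : Fin n // i ∈ S.1}

namespace Pairs

variable {n : ℕ} {𝒮 : Finset (Finset (Fin n))}

/-- The assortment `S` of a pair `(i, S)`. -/
abbrev assortment (x : Pairs 𝒮) : {S : Finset (Fin n) // S ∈ 𝒮} := x.1

/-- The product `i` of a pair `(i, S)`. -/
abbrev product (x : Pairs 𝒮) : Fin n := x.2.1

end Pairs

/-- A choice probability collection: non-negative numbers `p_{i,S}`, one for each pair `(i, S)`,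
which sum to one over every assortment. -/
def IsChoiceCollection {n : ℕ} {𝒮 : Finset (Finset (Fin n))} (p : Pairs 𝒮 → ℝ) : Prop :=
  (∀ x, 0 ≤ p x) ∧ ∀ S : {S : Finset (Fin n) // S ∈ 𝒮}, ∑ i : {i : Fin n // i ∈ S.1}, p ⟨S, i⟩ = 1

/-- The standing assumption on the law of a noise term: an absolutely continuous probability
distribution on `ℝ` with finite first absolute moment, whose distribution function is strictly
increasing on the support. -/
structure IsAdmissibleMarginal (F : Measure ℝ) : Prop where
  isProbabilityMeasure : IsProbabilityMeasure F
  absolutelyContinuous : F ≪ volume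
  strictMonoOn_cdf : StrictMonoOn (fun x => cdf F x) F.support
  integrable_id : Integrable (fun x : ℝ => x) F

/-- The set `Θ` of all joint laws of the noise vector with the given marginals. -/
def jointLaws {n : ℕ} (F : Fin n → Measure ℝ) : Set (Measure (Fin n → ℝ)) :=
  {θ | IsProbabilityMeasure θ ∧ ∀ i, θ.map (fun ε => ε i) = F i}

/-- The expectation under `θ` of the maximal utility `max_{i ∈ S} (ν_i + ε_i)`. -/
noncomputable def expectedMaxUtility {n : ℕ} (ν : Fin n → ℝ) (S : Finset (Fin n))
    (hS : S.Nonempty) (θ : Measure (Fin n → ℝ)) : ℝ :=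
  ∫ ε, S.sup' hS (fun i => ν i + ε i) ∂θ

/-- The event `i = argmax_{j ∈ S} (ν_j + ε_j)`. -/
def argmaxEvent {n : ℕ} (ν : Fin n → ℝ) (S : Finset (Fin n)) (i : Fin n) : Set (Fin n → ℝ) :=
  {ε | ∀ j ∈ S, j ≠ i → ν j + ε j < ν i + ε i}

/-- The marginal distribution model with marginals `F` and deterministic utilities `ν` yields the
probabilities `p`: for every assortment `S`, some joint law that maximizes the expected maximal
utility over all joint laws with marginals `F` has `p_{i,S}` as the probability of choosing `i`. -/
def MDMYields {n : ℕ} {𝒮 : Finset (Finset (Fin n))} (F : Fin n → Measure ℝ) (ν : Fin n → ℝ)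
    (p : Pairs 𝒮 → ℝ) : Prop :=
  ∀ S : {S : Finset (Fin n) // S ∈ 𝒮}, ∃ hS : S.1.Nonempty, ∃ θ ∈ jointLaws F,
    IsMaxOn (expectedMaxUtility ν S.1 hS) (jointLaws F) θ ∧
      ∀ i : {i : Fin n // i ∈ S.1}, p ⟨S, i⟩ = θ.real (argmaxEvent ν S.1 i.1)

/-- `p` is representable by a marginal distribution model in which all the products of a group
have the same marginal; the group of the product `i` is `g i`. -/
def IsGroupedRepresentable {n K : ℕ} (g : Fin n → Fin K) {𝒮 : Finset (Finset (Fin n))}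
    (p : Pairs 𝒮 → ℝ) : Prop :=
  ∃ (F : Fin n → Measure ℝ) (ν : Fin n → ℝ), (∀ i, IsAdmissibleMarginal (F i)) ∧
    (∃ Fhat : Fin K → Measure ℝ, ∀ i, F i = Fhat (g i)) ∧ MDMYields F ν p

/-- As `IsGroupedRepresentable`, where moreover different groups have different marginals. -/
def IsDistinctGroupedRepresentable {n K : ℕ} (g : Fin n → Fin K) {𝒮 : Finset (Finset (Fin n))}
    (p : Pairs 𝒮 → ℝ) : Prop :=
  ∃ (F : Fin n → Measure ℝ) (ν : Fin n → ℝ), (∀ i, IsAdmissibleMarginal (F i)) ∧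
    (∃ Fhat : Fin K → Measure ℝ, Function.Injective Fhat ∧ ∀ i, F i = Fhat (g i)) ∧
      MDMYields F ν p

/-- A linear program in the variables `V` (unrestricted in sign): maximize `∑ v, obj v * x v`
subject to the inequalities `∑ v, ineqCoeff c v * x v ≥ ineqRhs c` (`c : I`) and the equations
`∑ v, eqCoeff c v * x v = eqRhs c` (`c : E`). -/
structure LinearProgram (V I E : Type) [Fintype V] [Finite I] [Finite E] where
  obj : V → ℝ
  ineqCoeff : I → V → ℝ
  ineqRhs : I → ℝ
  eqCoeff : E → V → ℝ
  eqRhs : E → ℝ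

namespace LinearProgram

variable {V I E : Type} [Fintype V] [Finite I] [Finite E]

/-- The feasible points. -/
def feasible (P : LinearProgram V I E) : Set (V → ℝ) :=
  {x | (∀ c, P.ineqRhs c ≤ ∑ v, P.ineqCoeff c v * x v) ∧
    ∀ c, ∑ v, P.eqCoeff c v * x v = P.eqRhs c}

/-- The optimal value: `⊥` for an infeasible program, `⊤` for an unbounded one. -/
noncomputable def value (P : LinearProgram V I E) : EReal :=
  ⨆ x ∈ P.feasible, ((∑ v, P.obj v * x v : ℝ) : EReal)

/-- The number of variables. -/
noncomputable def numVars (_P : LinearProgram V I E) : ℕ := Fintype.card V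

/-- The number of constraints. -/
noncomputable def numConstraints (_P : LinearProgram V I E) : ℕ := Nat.card I + Nat.card E

end LinearProgram

/-- The variables of the test program: `λ_S` for `S ∈ 𝒮`, `ν_i` for the products `i`, and `ε`. -/
abbrev TestVar {n : ℕ} (𝒮 : Finset (Finset (Fin n))) : Type :=
  {S : Finset (Fin n) // S ∈ 𝒮} ⊕ Fin n ⊕ Unit

/-- The ordered pairs `(i, S)`, `(j, T)` with `g i = g j` and `p_{i,S} < p_{j,T}`. -/
abbrev StrictRows {n K : ℕ} (g : Fin n → Fin K) {𝒮 : Finset (Finset (Fin n))}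
    (p : Pairs 𝒮 → ℝ) : Type :=
  {c : Pairs 𝒮 × Pairs 𝒮 // g c.1.product = g c.2.product ∧ p c.1 < p c.2}

/-- The ordered pairs `(i, S)`, `(j, T)` with `g i = g j` and `p_{i,S} = p_{j,T} ≠ 0`. -/
abbrev TieRows {n K : ℕ} (g : Fin n → Fin K) {𝒮 : Finset (Finset (Fin n))}
    (p : Pairs 𝒮 → ℝ) : Type :=
  {c : Pairs 𝒮 × Pairs 𝒮 // g c.1.product = g c.2.product ∧ p c.1 = p c.2 ∧ p c.1 ≠ 0}

/-- The coefficients of the linear form `(λ_S - ν_i) - (λ_T - ν_j)`. -/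
def gapCoeff {n : ℕ} {𝒮 : Finset (Finset (Fin n))} (x y : Pairs 𝒮) : TestVar 𝒮 → ℝ :=
  Pi.single (Sum.inl x.assortment) 1 - Pi.single (Sum.inr (Sum.inl x.product)) 1
    - (Pi.single (Sum.inl y.assortment) 1 - Pi.single (Sum.inr (Sum.inl y.product)) 1)

/-- The coefficients of the linear form `ε`. -/
def epsCoeff {n : ℕ} (𝒮 : Finset (Finset (Fin n))) : TestVar 𝒮 → ℝ :=
  Pi.single (Sum.inr (Sum.inr ())) 1

/-- The linear program: maximize `ε` subject to, for all `(i, S)` and `(j, T)` with `g i = g j`,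
`(λ_S - ν_i) - (λ_T - ν_j) - ε ≥ 0` if `p_{i,S} < p_{j,T}`, and
`(λ_S - ν_i) - (λ_T - ν_j) = 0` if `p_{i,S} = p_{j,T} ≠ 0`. -/
def testProgram {n K : ℕ} (g : Fin n → Fin K) {𝒮 : Finset (Finset (Fin n))}
    (p : Pairs 𝒮 → ℝ) : LinearProgram (TestVar 𝒮) (StrictRows g p) (TieRows g p) where
  obj := epsCoeff 𝒮
  ineqCoeff c := gapCoeff c.1.1 c.1.2 - epsCoeff 𝒮
  ineqRhs _ := 0
  eqCoeff c := gapCoeff c.1.1 c.1.2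
  eqRhs _ := 0

end ChoiceModel

namespace ChoiceModel

/-! For every level `l` the maximal utility over `S` is at most `l` plus the sum of the excesses of
the utilities over `l`, and the expectation of this bound depends on the marginals only. If the
probabilities of exceeding `l` add up to one over `S`, a coupling makes these events a partition of
almost every outcome and attains the bound (`exists_mem_jointLaws_expectedMaxUtility_eq`). Every
optimal law then has equality almost surely, which forces `p_{i,S} = 1 - F_i(l - ν_i)`
(`measureReal_argmaxEvent_of_isMaxOn`).

So a representation amounts to tail probabilities at the thresholds `λ(S) - ν_i`. Products of a
group share one distribution function, which is injective where its values lie strictly between 0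
and 1; hence the order conditions. Pairs with probability one do not determine a threshold, and
`IsGroupedRepresentable.exists_isSeparating` assigns them one.

Conversely, finitely many thresholds in the right order are interpolated by an admissible law for
each group (`exists_admissible_with_tails`). Translating these laws apart makes them distinct.
Finitely many strict inequalities have a common positive slack, which gives the linear program. -/

open Set Filter Topology

/-! ### Admissible laws with prescribed tails -/

/-- A strictly increasing function on a finite set of reals extends to a function on the line
whose slopes lie between two positive constants. -/
theorem exists_bilipschitz_interpolation (s : Finset ℝ) (W : ℝ → ℝ) (hW : StrictMonoOn W s) :
    ∃ (G : ℝ → ℝ) (δ L : ℝ), 0 < δ ∧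
      (∀ t u, t ≤ u → δ * (u - t) ≤ G u - G t ∧ G u - G t ≤ L * (u - t)) ∧
      ∀ z ∈ s, G z = W z := by
  induction s using Finset.induction_on_max with
  | empty => exact ⟨id, 1, 1, one_pos, fun t u _ => by simp, by simp⟩
  | insert b s hb ih =>
    obtain ⟨G, δ, L, hδ, hG, hGW⟩ := ih (hW.mono (by simp))
    rcases s.eq_empty_or_nonempty with rfl | hs
    · refine ⟨fun t => W b + (t - b), 1, 1, one_pos, fun t u _ => ?_, by simp⟩
      constructor <;> apply le_of_eq <;> ring
    · set m := s.max' hs with hm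
      have hms : m ∈ s := s.max'_mem hs
      have hmb : 0 < b - m := sub_pos.2 (hb m hms)
      have hWmb : 0 < W b - W m :=
        sub_pos.2 (hW (by simp [hms]) (by simp) (hb m hms))
      set k := (W b - W m) / (b - m) with hk
      have hkpos : 0 < k := div_pos hWmb hmb
      -- Up to the old maximum `m` keep `G`; beyond it continue affinely with the slope `k` that
      -- reaches `W b` at `b`.
      refine ⟨fun t => G (min t m) + k * max (t - m) 0, min δ k, max L k, lt_min hδ hkpos,
        fun t u htu => ?_, fun z hz => ?_⟩
      · have h₁ := hG (min t m) (min u m) (min_le_min_right m htu)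
        have hα : 0 ≤ min u m - min t m := sub_nonneg.2 (min_le_min_right m htu)
        have hβ : 0 ≤ max (u - m) 0 - max (t - m) 0 :=
          sub_nonneg.2 (max_le_max_right 0 (by linarith))
        have hsum (x : ℝ) : x = min x m + max (x - m) 0 := by
          rcases le_total x m with h | h
          · rw [min_eq_left h, max_eq_right (by linarith)]; ring
          · rw [min_eq_right h, max_eq_left (by linarith)]; ring
        have e : u - t = (min u m - min t m) + (max (u - m) 0 - max (t - m) 0) := by
          linarith [hsum u, hsum t]
        rw [e]
        constructor
        · have h₂ := mul_le_mul_of_nonneg_right (min_le_left δ k) hα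
          have h₃ := mul_le_mul_of_nonneg_right (min_le_right δ k) hβ
          linarith
        · have h₂ := mul_le_mul_of_nonneg_right (le_max_left L k) hα
          have h₃ := mul_le_mul_of_nonneg_right (le_max_right L k) hβ
          linarith
      · obtain rfl | hz := Finset.mem_insert.1 hz
        · beta_reduce
          rw [min_eq_right (sub_pos.1 hmb).le, max_eq_left hmb.le, hGW m hms, hk,
            div_mul_cancel₀ _ hmb.ne']
          ring
        · have hzm : z ≤ m := s.le_max' z hz
          beta_reduce
          rw [min_eq_left hzm, max_eq_right (by linarith), hGW z hz]
          ring

/-- The law with distribution function `max 0 (min 1 G)`, for `G` with slopes between two positive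
constants, is an admissible marginal. -/
theorem exists_admissible_of_bilipschitz (G : ℝ → ℝ) (δ L : ℝ) (hδ : 0 < δ)
    (hG : ∀ t u, t ≤ u → δ * (u - t) ≤ G u - G t ∧ G u - G t ≤ L * (u - t)) (a b : ℝ)
    (ha : G a ≤ 0) (hb : 1 ≤ G b) :
    ∃ F : Measure ℝ, IsAdmissibleMarginal F ∧ F (Icc a b)ᶜ = 0 ∧
      ∀ t, cdf F t = max 0 (min 1 (G t)) := by
  have hmono : StrictMono G := fun t u htu => by
    have := (hG t u htu.le).1
    nlinarith [mul_pos hδ (sub_pos.2 htu)]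
  have hL : 0 < L := by
    have := hG 0 1 zero_le_one
    linarith
  have hlip : LipschitzWith L.toNNReal G := by
    refine LipschitzWith.of_dist_le_mul fun t u => ?_
    rw [Real.coe_toNNReal _ hL.le]
    wlog htu : t ≤ u generalizing t u
    · rw [dist_comm, dist_comm t]; exact this u t (le_of_not_ge htu)
    · rw [dist_comm, dist_comm t, Real.dist_eq, Real.dist_eq, abs_of_nonneg (sub_nonneg.2 htu),
        abs_of_nonneg (sub_nonneg.2 (hmono.monotone htu))]
      exact (hG t u htu).2
  have htop : Filter.Tendsto G Filter.atTop Filter.atTop := by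
    refine Filter.tendsto_atTop_mono' _ ?_ (Filter.tendsto_atTop_add_const_left _ (G 0)
      (Filter.tendsto_id.const_mul_atTop hδ))
    filter_upwards [Filter.eventually_ge_atTop 0] with u hu
    have := (hG 0 u hu).1
    simp only [id, sub_zero] at *
    linarith
  have hbot : Filter.Tendsto G Filter.atBot Filter.atBot := by
    refine Filter.tendsto_atBot_mono' _ ?_ (Filter.tendsto_atBot_add_const_left _ (G 0)
      (Filter.tendsto_id.const_mul_atBot hδ))
    filter_upwards [Filter.eventually_le_atBot 0] with u hu
    have := (hG u 0 hu).1
    simp only [id, zero_sub] at *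
    linarith
  have hsurj : Function.Surjective G := hlip.continuous.surjective htop hbot
  let e : ℝ ≃o ℝ := hmono.orderIsoOfSurjective G hsurj
  have he (t : ℝ) : e t = G t := rfl
  have hemeas : Measurable e.symm := e.symm.monotone.measurable
  -- `F` is the image of the uniform law on `[0, 1]` under the inverse of `G`.
  let μ : Measure ℝ := volume.restrict (Icc 0 1)
  have hμ : IsProbabilityMeasure μ := ⟨by simp [μ]⟩
  let F : Measure ℝ := μ.map e.symm
  have hF : IsProbabilityMeasure F := Measure.isProbabilityMeasure_map hemeas.aemeasurable
  have hcdf (t : ℝ) : cdf F t = max 0 (min 1 (G t)) := by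
    have hset : e.symm ⁻¹' Iic t ∩ Icc 0 1 = Icc 0 (min 1 (G t)) := by
      ext u
      simp only [mem_inter_iff, mem_preimage, mem_Iic, mem_Icc, le_min_iff]
      rw [e.symm_apply_le, he]
      tauto
    rw [cdf_eq_real, measureReal_def, Measure.map_apply hemeas measurableSet_Iic,
      Measure.restrict_apply (hemeas measurableSet_Iic), hset, Real.volume_Icc, sub_zero,
      ENNReal.toReal_ofReal', max_comm]
  have hsupp : F (Icc (e.symm 0) (e.symm 1))ᶜ = 0 := by
    rw [Measure.map_apply hemeas measurableSet_Icc.compl]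
    have : e.symm ⁻¹' (Icc (e.symm 0) (e.symm 1))ᶜ = (Icc 0 1)ᶜ := by
      ext u; simp
    rw [this, Measure.restrict_apply measurableSet_Icc.compl]
    simp
  have hcompl : F (Icc a b)ᶜ = 0 := by
    refine measure_mono_null (compl_subset_compl.2 (Icc_subset_Icc ?_ ?_)) hsupp
    · rw [e.le_symm_apply]; exact ha
    · rw [e.symm_apply_le]; exact hb
  refine ⟨F, ⟨hF, ?_, ?_, ?_⟩, hcompl, hcdf⟩
  -- The `F`-mass of `N` is at most the length of `G '' N`, and the Lipschitz map `G` preserves null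
  -- sets.
  · refine Measure.AbsolutelyContinuous.mk fun N hN hN0 => ?_
    rw [Measure.map_apply hemeas hN, ← e.image_eq_preimage_symm]
    refine le_antisymm ((Measure.restrict_apply_le _ _).trans ?_) zero_le
    have := hlip.hausdorffMeasure_image_le (d := 1) zero_le_one N
    rw [hausdorffMeasure_real, hN0, mul_zero] at this
    exact this
  · have hsub : F.support ⊆ Icc (e.symm 0) (e.symm 1) :=
      Measure.support_subset_of_isClosed isClosed_Icc hsupp
    have hval {t : ℝ} (ht : t ∈ F.support) : cdf F t = G t := by
      obtain ⟨h₀, h₁⟩ := hsub ht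
      rw [e.symm_apply_le, he] at h₀
      rw [e.le_symm_apply, he] at h₁
      rw [hcdf, min_eq_right h₁, max_eq_right h₀]
    intro t ht u hu htu
    simp only [hval ht, hval hu]
    exact hmono htu
  · refine Integrable.of_bound (C := max |a| |b|) measurable_id.aestronglyMeasurable ?_
    filter_upwards [compl_mem_ae_iff.2 hcompl] with x hx
    rw [compl_compl] at hx
    exact abs_le_max_abs_abs hx.1 hx.2

/-- Finitely many prescribed upper tail probabilities, decreasing in the threshold and strictly so
where they are positive, are those of an admissible marginal with support in a given interval. -/
theorem exists_admissible_with_tails {ι : Type*} [Finite ι] (z p : ι → ℝ) (a b : ℝ) (hab : a < b)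
    (hz : ∀ i, a < z i ∧ z i < b) (hp : ∀ i, 0 ≤ p i ∧ p i ≤ 1)
    (hlt : ∀ i j, p i < p j → z j < z i) (heq : ∀ i j, p i = p j → p i ≠ 0 → z i = z j) :
    ∃ F : Measure ℝ, IsAdmissibleMarginal F ∧ F (Icc a b)ᶜ = 0 ∧ ∀ i, cdf F (z i) = 1 - p i := by
  classical
  let zz : ι ⊕ Bool → ℝ := Sum.elim z fun c => if c then b else a
  -- Several thresholds may carry `p i = 0`, where the distribution function is constantly 1. The
  -- values there are spread strictly above 1, so that interpolation by a strictly increasing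
  -- function is possible; truncation at 1 undoes this. The endpoints get values outside `[0, 1]` to
  -- confine the support to `[a, b]`.
  let w : ι ⊕ Bool → ℝ :=
    Sum.elim (fun i => if p i = 0 then 1 + (z i - a) else 1 - p i)
      fun c => if c then 1 + (b - a) else -1
  have hw (i : ι) : -1 < w (.inl i) ∧ w (.inl i) < 1 + (b - a) := by
    have := hz i
    have := hp i
    simp only [w, Sum.elim_inl]
    split_ifs <;> constructor <;> linarith
  have hinl {i j : ι} (h : z i < z j) : w (.inl i) < w (.inl j) := by
    have hi := hp i
    have hj := hp j
    have hle : p j ≤ p i := le_of_not_gt fun h' => (hlt i j h').not_gt h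
    simp only [w, Sum.elim_inl]
    split_ifs with h₁ h₂ h₂
    · linarith
    · exact absurd (le_antisymm (h₁ ▸ hle) hj.1) h₂
    · have := hz j
      have := lt_of_le_of_ne hi.1 (Ne.symm h₁)
      linarith
    · have : p j ≠ p i := fun h' => h.ne (heq i j h'.symm h₁)
      have := lt_of_le_of_ne hle this
      linarith
  have hmono {x y : ι ⊕ Bool} (h : zz x < zz y) : w x < w y := by
    rcases x with i | c <;> rcases y with j | d
    · exact hinl h
    · cases d
      · exact absurd h (hz i).1.not_gt
      · exact (hw i).2
    · cases c
      · exact (hw j).1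
      · exact absurd h (hz j).2.not_gt
    · cases c <;> cases d <;> simp [zz, w] at h ⊢ <;> linarith
  have hfac : w.FactorsThrough zz := by
    rintro (i | c) (j | d) h
    · have h : z i = z j := h
      have hpp : p i = p j := by
        rcases lt_trichotomy (p i) (p j) with h' | h' | h'
        · exact absurd h (hlt i j h').ne'
        · exact h'
        · exact absurd h (hlt j i h').ne
      simp [w, hpp, h]
    · have := hz i
      cases d <;> simp [zz] at h <;> linarith
    · have := hz j
      cases c <;> simp [zz] at h <;> linarith
    · cases c <;> cases d <;> simp [zz, w] at h ⊢ <;> linarith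
  let W : ℝ → ℝ := Function.extend zz w 0
  have hWz (x) : W (zz x) = w x := hfac.extend_apply 0 x
  have := Fintype.ofFinite ι
  obtain ⟨G, δ, L, hδ, hG, hGW⟩ := exists_bilipschitz_interpolation (Finset.univ.image zz) W (by
    intro s hs t ht hst
    simp only [Finset.coe_image, Finset.coe_univ, image_univ, mem_range] at hs ht
    obtain ⟨x, rfl⟩ := hs
    obtain ⟨y, rfl⟩ := ht
    rw [hWz, hWz]
    exact hmono hst)
  have hGz (x) : G (zz x) = w x := by
    rw [hGW _ (Finset.mem_image_of_mem _ (Finset.mem_univ x)), hWz]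
  have hGa : G a = -1 := hGz (.inr false)
  have hGb : G b = 1 + (b - a) := hGz (.inr true)
  obtain ⟨F, hF, hFab, hcdf⟩ := exists_admissible_of_bilipschitz G δ L hδ hG a b
    (by linarith) (by linarith)
  refine ⟨F, hF, hFab, fun i => ?_⟩
  have hi := hp i
  rw [hcdf, show G (z i) = w (.inl i) from hGz (.inl i)]
  simp only [w, Sum.elim_inl]
  split_ifs with h
  · have := hz i
    rw [min_eq_left (by linarith), h]
    norm_num
  · rw [min_eq_right (by linarith), max_eq_right (by linarith)]

/-! ### The pointwise bound on the maximum and its equality case -/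

section Pointwise

variable {n : ℕ} {S : Finset (Fin n)} {u : Fin n → ℝ} {l : ℝ}

theorem sup'_le_add_sum_posPart (hS : S.Nonempty) :
    S.sup' hS u ≤ l + ∑ i ∈ S, max (u i - l) 0 := by
  refine Finset.sup'_le hS _ fun j hj => ?_
  have h₁ := Finset.single_le_sum (f := fun i => max (u i - l) 0)
    (fun i _ => le_max_right _ _) hj
  have h₂ := le_max_left (u j - l) 0
  linarith

/-- Equality in `sup'_le_add_sum_posPart`: one utility is at least `l` and all others at most `l`. -/
theorem sup'_eq_add_sum_posPart (hS : S.Nonempty) {i : Fin n} (hi : i ∈ S) (hl : l ≤ u i)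
    (h : ∀ j ∈ S, j ≠ i → u j ≤ l) : S.sup' hS u = l + ∑ i ∈ S, max (u i - l) 0 := by
  refine le_antisymm (sup'_le_add_sum_posPart hS) ?_
  rw [Finset.sum_eq_single_of_mem i hi fun j hj hji => max_eq_right (sub_nonpos.2 (h j hj hji)),
    max_eq_left (sub_nonneg.2 hl)]
  have := Finset.le_sup' u hi
  linarith

/-- In the equality case the largest excess uses up the whole sum of excesses, so no second utility
exceeds `l`. Since no utility equals `l`, the maximum itself exceeds `l`. -/
theorem lt_iff_isArgmax_of_sup'_eq (hS : S.Nonempty)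
    (h : S.sup' hS u = l + ∑ i ∈ S, max (u i - l) 0) (hne : ∀ i ∈ S, u i ≠ l) {i : Fin n}
    (hi : i ∈ S) : l < u i ↔ ∀ j ∈ S, j ≠ i → u j < u i := by
  classical
  obtain ⟨k, hk, hku⟩ := Finset.exists_mem_eq_sup' hS u
  have hnn : ∀ i ∈ S, 0 ≤ max (u i - l) 0 := fun _ _ => le_max_right _ _
  have hkl : l < u k := by
    have := Finset.sum_nonneg hnn
    exact lt_of_le_of_ne (by linarith) (hne k hk).symm
  have hother : ∀ j ∈ S, j ≠ k → u j < l := by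
    intro j hj hjk
    have h₁ := Finset.add_sum_erase S (fun i => max (u i - l) 0) hk
    have h₂ := Finset.single_le_sum (f := fun i => max (u i - l) 0)
      (fun i hi => hnn i (Finset.mem_of_mem_erase hi)) (Finset.mem_erase.2 ⟨hjk, hj⟩)
    have h₃ := le_max_left (u j - l) 0
    simp only [max_eq_left (sub_nonneg.2 hkl.le)] at h₁ h₂
    exact lt_of_le_of_ne (by linarith) (hne j hj)
  constructor
  · intro hli j hj hji
    obtain rfl : i = k := by
      by_contra hik
      exact (hother i hi hik).not_gt hli
    exact (hother j hj hji).trans hli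
  · intro hmax
    by_cases hik : i = k
    · rwa [hik]
    · exact hkl.trans (hmax k hk (Ne.symm hik))

end Pointwise

/-! ### Coupling events into a partition -/

/-- The conditional law given `B`, or the law itself if `B` is negligible. -/
noncomputable def condOrSelf (μ : Measure ℝ) (B : Set ℝ) : Measure ℝ :=
  open Classical in if μ B = 0 then μ else μ[|B]

instance (μ : Measure ℝ) [IsProbabilityMeasure μ] (B : Set ℝ) :
    IsProbabilityMeasure (condOrSelf μ B) := by
  unfold condOrSelf
  split_ifs with h
  · infer_instance
  · exact cond_isProbabilityMeasure h

/-- The fallback for negligible `B` is harmless because it enters mixtures with weight zero. -/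
theorem measure_smul_condOrSelf (μ : Measure ℝ) [IsProbabilityMeasure μ] (B : Set ℝ) :
    μ B • condOrSelf μ B = μ.restrict B := by
  unfold condOrSelf
  split_ifs with h
  · rw [h, zero_smul, Measure.restrict_eq_zero.2 h]
  · rw [ProbabilityTheory.cond, smul_smul, ENNReal.mul_inv_cancel h (measure_ne_top μ B), one_smul]

theorem ae_condOrSelf_mem {μ : Measure ℝ} {B : Set ℝ} (hB : MeasurableSet B) (h : μ B ≠ 0) :
    ∀ᵐ x ∂condOrSelf μ B, x ∈ B := by
  rw [condOrSelf, if_neg h]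
  exact ae_cond_mem hB

/-- If the probabilities of the events `ε i ∈ A i`, `i ∈ S`, add up to one under the marginals,
then some joint law makes these events a partition of almost every outcome. -/
theorem exists_mem_jointLaws_ae_existsUnique {n : ℕ} (F : Fin n → Measure ℝ)
    [∀ i, IsProbabilityMeasure (F i)] (S : Finset (Fin n)) (A : Fin n → Set ℝ)
    (hA : ∀ i, MeasurableSet (A i)) (hsum : ∑ i ∈ S, F i (A i) = 1) :
    ∃ θ ∈ jointLaws F, ∀ᵐ ε ∂θ, ∃ i ∈ S, ε i ∈ A i ∧ ∀ j ∈ S, j ≠ i → ε j ∉ A j := by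
  classical
  -- A winner `i ∈ S` is drawn with probability `F i (A i)`. Given `i`, the coordinates are
  -- independent: the winner is conditioned on `A i`, every other `j ∈ S` on the complement of `A
  -- j`.
  let G (i j : Fin n) : Measure ℝ :=
    if j ∈ S then (if j = i then condOrSelf (F j) (A j) else condOrSelf (F j) (A j)ᶜ) else F j
  have hGprob (i j) : IsProbabilityMeasure (G i j) := by
    simp only [G]
    split_ifs <;> infer_instance
  -- This is why the marginals come out right: the probability that `j` loses equals the mass of the
  -- complement of `A j`.
  have hcompl {j : Fin n} (hj : j ∈ S) : ∑ i ∈ S.erase j, F i (A i) = F j (A j)ᶜ := by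
    have h₁ := Finset.add_sum_erase S (fun i => F i (A i)) hj
    have h₂ := measure_add_measure_compl (μ := F j) (hA j)
    rw [measure_univ, ← hsum, ← h₁] at h₂
    exact ((ENNReal.add_right_inj (measure_ne_top _ _)).1 h₂).symm
  let θ : Measure (Fin n → ℝ) := ∑ i ∈ S, F i (A i) • Measure.pi (G i)
  refine ⟨θ, ⟨⟨?_⟩, fun j => ?_⟩, ?_⟩
  · simp [θ, Measure.finsetSum_apply, hsum]
  · have hmap : θ.map (fun ε => ε j) = ∑ i ∈ S, F i (A i) • G i j := by
      simp only [θ]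
      rw [← Measure.mapₗ_apply_of_measurable (measurable_pi_apply j), map_sum]
      refine Finset.sum_congr rfl fun i _ => ?_
      rw [map_smul, Measure.mapₗ_apply_of_measurable (measurable_pi_apply j)]
      congr 1
      exact (measurePreserving_eval (G i) j).map_eq
    rw [hmap]
    by_cases hj : j ∈ S
    · rw [← Finset.add_sum_erase S _ hj,
        Finset.sum_congr rfl (g := fun i => F i (A i) • condOrSelf (F j) (A j)ᶜ) fun i hi => by
          simp [G, hj, (Finset.ne_of_mem_erase hi).symm],
        ← Finset.sum_smul, hcompl hj, measure_smul_condOrSelf]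
      simp only [G, hj, if_true]
      rw [measure_smul_condOrSelf, Measure.restrict_add_restrict_compl (hA j)]
    · simp only [G, hj, if_false]
      rw [← Finset.sum_smul, hsum, one_smul]
  · have hae {i : Fin n} (hi : i ∈ S) (hi0 : F i (A i) ≠ 0) : ∀ᵐ ε ∂(Measure.pi (G i)),
        ε i ∈ A i ∧ ∀ j ∈ S, j ≠ i → ε j ∉ A j := by
      refine Filter.Eventually.and ?_ ?_
      · have := (measurePreserving_eval (G i) i).quasiMeasurePreserving.ae
          (p := fun x => x ∈ A i) (by
            simp only [G, hi, if_true]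
            exact ae_condOrSelf_mem (hA i) hi0)
        exact this
      · rw [ae_all_iff]
        intro j
        by_cases hj : j ∈ S
        · by_cases hji : j = i
          · simp [hji]
          · have hj0 : F j (A j)ᶜ ≠ 0 := by
              rw [← hcompl hj]
              intro h0
              exact hi0 (Finset.sum_eq_zero_iff.1 h0 i
                (Finset.mem_erase.2 ⟨Ne.symm hji, hi⟩))
            have := (measurePreserving_eval (G i) j).quasiMeasurePreserving.ae
              (p := fun x => x ∉ A j) (by
                simp only [G, hj, hji, if_true, if_false]
                exact ae_condOrSelf_mem (hA j).compl hj0)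
            filter_upwards [this] with ε hε _ _ using hε
        · simp [hj]
    rw [ae_iff]
    simp only [θ, Measure.finsetSum_apply, Measure.smul_apply, smul_eq_mul]
    refine Finset.sum_eq_zero fun i hi => ?_
    by_cases hi0 : F i (A i) = 0
    · rw [hi0, zero_mul]
    · refine mul_eq_zero_of_right _ (measure_mono_null ?_ (ae_iff.1 (hae hi hi0)))
      intro ε hε h
      exact hε ⟨i, hi, h⟩

/-! ### Optimal joint laws and their choice probabilities -/

section Optimality

variable {n : ℕ} {F : Fin n → Measure ℝ} {θ : Measure (Fin n → ℝ)}

theorem measurePreserving_of_mem_jointLaws (hθ : θ ∈ jointLaws F) (i : Fin n) :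
    MeasurePreserving (fun ε : Fin n → ℝ => ε i) θ (F i) :=
  ⟨measurable_pi_apply i, hθ.2 i⟩

theorem integrable_posPart (hF : ∀ i, IsAdmissibleMarginal (F i)) (ν : Fin n → ℝ) (l : ℝ)
    (i : Fin n) : Integrable (fun x => max (ν i + x - l) 0) (F i) := by
  have := (hF i).isProbabilityMeasure
  exact (((integrable_const (ν i)).add (hF i).integrable_id).sub (integrable_const l)).pos_part

theorem integrable_posPart_eval (hF : ∀ i, IsAdmissibleMarginal (F i)) (hθ : θ ∈ jointLaws F)
    (ν : Fin n → ℝ) (l : ℝ) (i : Fin n) :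
    Integrable (fun ε => max (ν i + ε i - l) 0) θ :=
  (measurePreserving_of_mem_jointLaws hθ i).integrable_comp_of_integrable
    (integrable_posPart hF ν l i)

theorem integrable_add_sum_posPart (hF : ∀ i, IsAdmissibleMarginal (F i)) (hθ : θ ∈ jointLaws F)
    (ν : Fin n → ℝ) (S : Finset (Fin n)) (l : ℝ) :
    Integrable (fun ε => l + ∑ i ∈ S, max (ν i + ε i - l) 0) θ := by
  have := hθ.1
  exact (integrable_const l).add
    (integrable_finsetSum _ fun i _ => integrable_posPart_eval hF hθ ν l i)

theorem integral_add_sum_posPart (hF : ∀ i, IsAdmissibleMarginal (F i)) (hθ : θ ∈ jointLaws F)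
    (ν : Fin n → ℝ) (S : Finset (Fin n)) (l : ℝ) :
    ∫ ε, (l + ∑ i ∈ S, max (ν i + ε i - l) 0) ∂θ =
      l + ∑ i ∈ S, ∫ x, max (ν i + x - l) 0 ∂F i := by
  have := hθ.1
  rw [integral_add (integrable_const l)
      (integrable_finsetSum _ fun i _ => integrable_posPart_eval hF hθ ν l i),
    integral_finsetSum _ fun i _ => integrable_posPart_eval hF hθ ν l i]
  congr 1
  · simp
  · refine Finset.sum_congr rfl fun i _ => ?_
    rw [← hθ.2 i, integral_map (measurable_pi_apply i).aemeasurable]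
    rw [hθ.2 i]
    exact (integrable_posPart hF ν l i).aestronglyMeasurable

theorem integrable_sup' (hF : ∀ i, IsAdmissibleMarginal (F i)) (hθ : θ ∈ jointLaws F)
    (ν : Fin n → ℝ) {S : Finset (Fin n)} (hS : S.Nonempty) :
    Integrable (fun ε => S.sup' hS fun i => ν i + ε i) θ := by
  have := hθ.1
  have h : Integrable (S.sup' hS fun i (ε : Fin n → ℝ) => ν i + ε i) θ :=
    Finset.sup'_induction hS _ (p := fun f => Integrable f θ) (fun _ h₁ _ h₂ => h₁.sup h₂) fun i _ =>
      (integrable_const (ν i)).add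
        ((measurePreserving_of_mem_jointLaws hθ i).integrable_comp_of_integrable
          (hF i).integrable_id)
  convert h using 2 with ε
  rw [Finset.sup'_apply]

/-- For every level `l`, the expected maximal utility is bounded by a quantity that depends only on
the marginals. -/
theorem expectedMaxUtility_le (hF : ∀ i, IsAdmissibleMarginal (F i)) (hθ : θ ∈ jointLaws F)
    (ν : Fin n → ℝ) {S : Finset (Fin n)} (hS : S.Nonempty) (l : ℝ) :
    expectedMaxUtility ν S hS θ ≤ l + ∑ i ∈ S, ∫ x, max (ν i + x - l) 0 ∂F i := by
  rw [← integral_add_sum_posPart hF hθ]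
  exact integral_mono (integrable_sup' hF hθ ν hS) (integrable_add_sum_posPart hF hθ ν S l)
    fun ε => sup'_le_add_sum_posPart hS

theorem IsAdmissibleMarginal.measure_Ioi {μ : Measure ℝ} (hμ : IsAdmissibleMarginal μ) (x : ℝ) :
    μ (Ioi x) = ENNReal.ofReal (1 - cdf μ x) := by
  have := hμ.isProbabilityMeasure
  rw [← compl_Iic, prob_compl_eq_one_sub measurableSet_Iic, ← ofReal_cdf,
    ENNReal.ofReal_sub _ (cdf_nonneg μ x), ENNReal.ofReal_one]

/-- The bound `expectedMaxUtility_le` is attained at a level that the utilities exceed with total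
probability one. -/
theorem exists_mem_jointLaws_expectedMaxUtility_eq (hF : ∀ i, IsAdmissibleMarginal (F i))
    (ν : Fin n → ℝ) {S : Finset (Fin n)} (hS : S.Nonempty) (l : ℝ)
    (hsum : ∑ i ∈ S, (1 - cdf (F i) (l - ν i)) = 1) :
    ∃ θ ∈ jointLaws F,
      expectedMaxUtility ν S hS θ = l + ∑ i ∈ S, ∫ x, max (ν i + x - l) 0 ∂F i := by
  have := fun i => (hF i).isProbabilityMeasure
  obtain ⟨θ, hθ, hae⟩ := exists_mem_jointLaws_ae_existsUnique F S (fun i => Ioi (l - ν i))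
    (fun _ => measurableSet_Ioi) (by
      simp only [(hF _).measure_Ioi]
      rw [← ENNReal.ofReal_sum_of_nonneg fun i _ => sub_nonneg.2 (cdf_le_one _ _), hsum,
        ENNReal.ofReal_one])
  refine ⟨θ, hθ, ?_⟩
  rw [← integral_add_sum_posPart hF hθ]
  refine integral_congr_ae ?_
  filter_upwards [hae] with ε ⟨i, hi, hil, hj⟩
  simp only [mem_Ioi, not_lt] at hil hj
  exact sup'_eq_add_sum_posPart hS hi (by linarith) fun j hjS hji => by
    linarith [hj j hjS hji]

theorem exists_isMaxOn_expectedMaxUtility (hF : ∀ i, IsAdmissibleMarginal (F i))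
    (ν : Fin n → ℝ) {S : Finset (Fin n)} (hS : S.Nonempty) (l : ℝ)
    (hsum : ∑ i ∈ S, (1 - cdf (F i) (l - ν i)) = 1) :
    ∃ θ ∈ jointLaws F, IsMaxOn (expectedMaxUtility ν S hS) (jointLaws F) θ := by
  obtain ⟨θ, hθ, h⟩ := exists_mem_jointLaws_expectedMaxUtility_eq hF ν hS l hsum
  exact ⟨θ, hθ, fun θ' hθ' => (expectedMaxUtility_le hF hθ' ν hS l).trans h.ge⟩

/-- Under an optimal joint law, the choice probabilities are the probabilities of exceeding the
level `l`. -/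
theorem measureReal_argmaxEvent_of_isMaxOn (hF : ∀ i, IsAdmissibleMarginal (F i))
    (ν : Fin n → ℝ) {S : Finset (Fin n)} (hS : S.Nonempty) (l : ℝ)
    (hsum : ∑ i ∈ S, (1 - cdf (F i) (l - ν i)) = 1) (hθ : θ ∈ jointLaws F)
    (hmax : IsMaxOn (expectedMaxUtility ν S hS) (jointLaws F) θ) {i : Fin n} (hi : i ∈ S) :
    θ.real (argmaxEvent ν S i) = 1 - cdf (F i) (l - ν i) := by
  have hprob := fun i => (hF i).isProbabilityMeasure
  obtain ⟨θ₀, hθ₀, h₀⟩ := exists_mem_jointLaws_expectedMaxUtility_eq hF ν hS l hsum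
  have heq : ∫ ε, S.sup' hS (fun i => ν i + ε i) ∂θ =
      ∫ ε, (l + ∑ i ∈ S, max (ν i + ε i - l) 0) ∂θ := by
    rw [integral_add_sum_posPart hF hθ, ← h₀]
    exact le_antisymm (h₀ ▸ expectedMaxUtility_le hF hθ ν hS l) (hmax hθ₀)
  have hae := (integral_eq_iff_of_ae_le (integrable_sup' hF hθ ν hS)
    (integrable_add_sum_posPart hF hθ ν S l)
    (ae_of_all _ fun ε => sup'_le_add_sum_posPart hS)).1 heq
  -- Absolute continuity of the marginals rules out utilities equal to the level.
  have hne : ∀ᵐ ε ∂θ, ∀ j, ν j + ε j ≠ l := by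
    rw [ae_all_iff]
    intro j
    have h : ∀ᵐ x ∂F j, x ≠ l - ν j := by
      simpa [ae_iff] using (hF j).absolutelyContinuous (measure_singleton (l - ν j))
    filter_upwards [(measurePreserving_of_mem_jointLaws hθ j).quasiMeasurePreserving.ae h]
      with ε hε h'
    exact hε (by linarith)
  have hev : argmaxEvent ν S i =ᵐ[θ] (fun ε : Fin n → ℝ => ε i) ⁻¹' Ioi (l - ν i) := by
    filter_upwards [hae, hne] with ε h₁ h₂
    have := lt_iff_isArgmax_of_sup'_eq hS h₁ (fun j _ => h₂ j) hi
    refine propext (this.symm.trans ?_)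
    exact sub_lt_iff_lt_add'.symm
  rw [measureReal_def, measure_congr hev,
    (measurePreserving_of_mem_jointLaws hθ i).measure_preimage measurableSet_Ioi.nullMeasurableSet,
    (hF i).measure_Ioi, ENNReal.toReal_ofReal (sub_nonneg.2 (cdf_le_one _ _))]

end Optimality

/-! ### Distribution functions of admissible laws -/

section Quantile

variable {μ : Measure ℝ}

theorem IsAdmissibleMarginal.continuous_cdf (hμ : IsAdmissibleMarginal μ) :
    Continuous (cdf μ) := by
  have := hμ.isProbabilityMeasure
  refine continuous_iff_continuousAt.2 fun x => ?_
  rw [(monotone_cdf μ).continuousAt_iff_leftLim_eq_rightLim, StieltjesFunction.rightLim_eq]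
  have h : μ {x} = 0 := hμ.absolutelyContinuous (measure_singleton x)
  rw [← measure_cdf μ, StieltjesFunction.measure_singleton, ENNReal.ofReal_eq_zero] at h
  exact le_antisymm ((monotone_cdf μ).leftLim_le le_rfl) (by linarith)

theorem measureReal_Ioc_eq_cdf_sub [IsProbabilityMeasure μ] {a b : ℝ} (hab : a ≤ b) :
    μ.real (Ioc a b) = cdf μ b - cdf μ a := by
  rw [cdf_eq_real, cdf_eq_real, ← Iic_union_Ioc_eq_Iic hab,
    measureReal_union (Iic_disjoint_Ioc le_rfl) measurableSet_Ioc, add_sub_cancel_left]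

/-- A point with positive distribution function can be moved down to the support without changing
the value of the distribution function. -/
theorem exists_mem_support_le_cdf_eq [IsProbabilityMeasure μ] {a : ℝ} (ha : 0 < cdf μ a) :
    ∃ x ∈ μ.support, x ≤ a ∧ cdf μ x = cdf μ a := by
  have hne : (Iic a ∩ μ.support).Nonempty := by
    refine Measure.nonempty_inter_support_of_pos ?_
    rw [← ofReal_cdf]
    exact ENNReal.ofReal_pos.2 ha
  have hbdd : BddAbove (Iic a ∩ μ.support) := ⟨a, fun x hx => hx.1⟩
  have hmem := (isClosed_Iic.inter Measure.isClosed_support).csSup_mem hne hbdd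
  refine ⟨_, hmem.2, hmem.1, ?_⟩
  have h := measureReal_Ioc_eq_cdf_sub (μ := μ) hmem.1
  have h0 : μ (Ioc (sSup (Iic a ∩ μ.support)) a) = 0 := by
    refine measure_mono_null (t := μ.supportᶜ) (fun x hx hxs => ?_) Measure.measure_compl_support
    exact hx.1.not_ge (le_csSup hbdd ⟨hx.2, hxs⟩)
  rw [measureReal_def, h0] at h
  simp at h
  linarith

/-- A point with distribution function below one can be moved up to the support without changing
the value of the distribution function. -/
theorem IsAdmissibleMarginal.exists_mem_support_ge_cdf_eq (hμ : IsAdmissibleMarginal μ) {b : ℝ}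
    (hb : cdf μ b < 1) : ∃ x ∈ μ.support, b ≤ x ∧ cdf μ x = cdf μ b := by
  have := hμ.isProbabilityMeasure
  have hne : (Ici b ∩ μ.support).Nonempty := by
    refine Measure.nonempty_inter_support_of_pos
      (lt_of_lt_of_le ?_ (measure_mono Ioi_subset_Ici_self))
    rw [hμ.measure_Ioi]
    exact ENNReal.ofReal_pos.2 (sub_pos.2 hb)
  have hbdd : BddBelow (Ici b ∩ μ.support) := ⟨b, fun x hx => hx.1⟩
  have hmem := (isClosed_Ici.inter Measure.isClosed_support).csInf_mem hne hbdd
  refine ⟨_, hmem.2, hmem.1, ?_⟩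
  have h := measureReal_Ioc_eq_cdf_sub (μ := μ) hmem.1
  have h0 : μ (Ioc b (sInf (Ici b ∩ μ.support))) = 0 := by
    refine measure_mono_null (t := μ.supportᶜ ∪ {sInf (Ici b ∩ μ.support)}) (fun x hx => ?_)
      (measure_union_null (Measure.measure_compl_support (μ := μ))
        (hμ.absolutelyContinuous (measure_singleton _)))
    by_cases hxs : x ∈ μ.support
    · exact Or.inr (le_antisymm hx.2 (csInf_le hbdd ⟨hx.1.le, hxs⟩))
    · exact Or.inl hxs
  rw [measureReal_def, h0] at h
  simp at h
  linarith

/-- If `a < b`, moving `a` down and `b` up into the support keeps the values, and strict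
monotonicity on the support separates them. -/
theorem IsAdmissibleMarginal.eq_of_cdf_eq (hμ : IsAdmissibleMarginal μ) {a b : ℝ}
    (h : cdf μ a = cdf μ b) (h₀ : 0 < cdf μ a) (h₁ : cdf μ a < 1) : a = b := by
  have := hμ.isProbabilityMeasure
  wlog hab : a < b generalizing a b
  · rcases (not_lt.1 hab).eq_or_lt with h' | h'
    · exact h'.symm
    · exact (this h.symm (h ▸ h₀) (h ▸ h₁) h').symm
  obtain ⟨x, hx, hxa, hxc⟩ := exists_mem_support_le_cdf_eq h₀
  obtain ⟨y, hy, hby, hyc⟩ := hμ.exists_mem_support_ge_cdf_eq (h ▸ h₁)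
  have := hμ.strictMonoOn_cdf hx hy (by linarith)
  simp only [hxc, hyc, h] at this
  exact absurd this (lt_irrefl _)

/-- Below any positive level there is a point that lies above all zeros of the distribution
function. -/
theorem IsAdmissibleMarginal.exists_cdf_lt_of_cdf_eq_zero_le (hμ : IsAdmissibleMarginal μ)
    {δ : ℝ} (hδ : 0 < δ) : ∃ c, cdf μ c < δ ∧ ∀ t, cdf μ t = 0 → t ≤ c := by
  by_cases hne : {t | cdf μ t = 0}.Nonempty
  · have hbdd : BddAbove {t | cdf μ t = 0} := by
      obtain ⟨b, hb⟩ := ((tendsto_cdf_atTop μ).eventually (lt_mem_nhds one_pos)).exists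
      refine ⟨b, fun t ht => le_of_not_gt fun hbt => ?_⟩
      exact (hb.trans_le (monotone_cdf μ hbt.le)).ne' ht
    have hclosed : IsClosed {t | cdf μ t = 0} := isClosed_singleton.preimage hμ.continuous_cdf
    have hmem := hclosed.csSup_mem hne hbdd
    refine ⟨sSup {t | cdf μ t = 0}, ?_, fun t ht => le_csSup hbdd ht⟩
    rw [show cdf μ (sSup {t | cdf μ t = 0}) = 0 from hmem]
    exact hδ
  · obtain ⟨c, hc⟩ := ((tendsto_cdf_atBot μ).eventually (gt_mem_nhds hδ)).exists
    exact ⟨c, hc, fun t ht => absurd ⟨t, ht⟩ hne⟩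

end Quantile

/-- The sum runs continuously from `S.card` at `-∞` to 0 at `+∞`. For a singleton the value 1 may be
only a limit, when the support is unbounded below; hence `1 < S.card`. -/
theorem exists_sum_one_sub_cdf_eq_one {n : ℕ} {F : Fin n → Measure ℝ}
    (hF : ∀ i, IsAdmissibleMarginal (F i)) (ν : Fin n → ℝ) {S : Finset (Fin n)}
    (hS : 1 < S.card) : ∃ l, ∑ i ∈ S, (1 - cdf (F i) (l - ν i)) = 1 := by
  have hcont : Continuous fun l => ∑ i ∈ S, (1 - cdf (F i) (l - ν i)) :=
    continuous_finsetSum _ fun i _ => continuous_const.sub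
      ((hF i).continuous_cdf.comp (continuous_id.sub continuous_const))
  have htop : Tendsto (fun l => ∑ i ∈ S, (1 - cdf (F i) (l - ν i))) atTop (𝓝 0) := by
    have := tendsto_finsetSum S fun i _ => ((tendsto_cdf_atTop (F i)).comp
      (tendsto_atTop_add_const_right atTop (-ν i) tendsto_id)).const_sub 1
    simpa [Function.comp_def, sub_eq_add_neg] using this
  have hbot : Tendsto (fun l => ∑ i ∈ S, (1 - cdf (F i) (l - ν i))) atBot (𝓝 S.card) := by
    have := tendsto_finsetSum S fun i _ => ((tendsto_cdf_atBot (F i)).comp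
      (tendsto_atBot_add_const_right atBot (-ν i) tendsto_id)).const_sub 1
    simpa [Function.comp_def, sub_eq_add_neg] using this
  obtain ⟨u, hu⟩ := (htop.eventually (gt_mem_nhds one_pos)).exists
  obtain ⟨v, hv⟩ := (hbot.eventually (lt_mem_nhds (Nat.one_lt_cast.2 hS))).exists
  exact mem_range_of_exists_le_of_exists_ge hcont ⟨u, hu.le⟩ ⟨v, hv.le⟩

/-! ### Representability and separating thresholds -/

section Characterization

variable {n K : ℕ} {g : Fin n → Fin K} {𝒮 : Finset (Finset (Fin n))} {p : Pairs 𝒮 → ℝ}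

theorem IsChoiceCollection.le_one (hp : IsChoiceCollection p) (x : Pairs 𝒮) : p x ≤ 1 := by
  rw [← hp.2 x.1]
  exact Finset.single_le_sum (f := fun i => p ⟨x.1, i⟩) (fun i _ => hp.1 _) (Finset.mem_univ x.2)

theorem IsChoiceCollection.nonempty (hp : IsChoiceCollection p)
    (S : {S : Finset (Fin n) // S ∈ 𝒮}) : S.1.Nonempty := by
  by_contra h
  have := hp.2 S
  have : IsEmpty {i : Fin n // i ∈ S.1} := ⟨fun i => h ⟨i, i.2⟩⟩
  simp_all

theorem IsChoiceCollection.eq_zero_of_ne (hp : IsChoiceCollection p)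
    {S : {S : Finset (Fin n) // S ∈ 𝒮}} {i j : {i : Fin n // i ∈ S.1}} (hi : p ⟨S, i⟩ = 1)
    (hij : j ≠ i) : p ⟨S, j⟩ = 0 := by
  classical
  have h₁ := hp.2 S
  rw [← Finset.add_sum_erase _ _ (Finset.mem_univ i), hi] at h₁
  have h₂ := Finset.single_le_sum (f := fun i => p ⟨S, i⟩) (fun i _ => hp.1 _)
    (Finset.mem_erase.2 ⟨hij, Finset.mem_univ j⟩)
  exact le_antisymm (by linarith) (hp.1 _)

theorem IsChoiceCollection.eq_one_of_card_le_one (hp : IsChoiceCollection p)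
    {S : {S : Finset (Fin n) // S ∈ 𝒮}} (hS : S.1.card ≤ 1) (i : {i : Fin n // i ∈ S.1}) :
    p ⟨S, i⟩ = 1 := by
  have : Subsingleton {i : Fin n // i ∈ S.1} :=
    ⟨fun a b => Subtype.ext (Finset.card_le_one.1 hS a a.2 b b.2)⟩
  rw [← hp.2 S, Fintype.sum_subsingleton _ i]

/-- The thresholds `lam S - ν i` within a group decrease strictly in the choice probability, and
pairs with equal positive probability have equal thresholds. -/
def IsSeparating (g : Fin n → Fin K) (p : Pairs 𝒮 → ℝ)
    (lam : {S : Finset (Fin n) // S ∈ 𝒮} → ℝ) (ν : Fin n → ℝ) : Prop :=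
  ∀ x y : Pairs 𝒮, g x.product = g y.product →
    (p x < p y → lam x.assortment - ν x.product > lam y.assortment - ν y.product) ∧
    (p x = p y ∧ p x ≠ 0 →
      lam x.assortment - ν x.product = lam y.assortment - ν y.product)

theorem IsGroupedRepresentable.exists_isSeparating (hp : IsChoiceCollection p)
    (h : IsGroupedRepresentable g p) : ∃ lam ν, IsSeparating g p lam ν := by
  classical
  obtain ⟨F, ν, hF, ⟨Fhat, hFhat⟩, hyield⟩ := h
  have hlevel (S : {S : Finset (Fin n) // S ∈ 𝒮}) : ∃ l, 1 < S.1.card →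
      ∀ i : {i : Fin n // i ∈ S.1}, cdf (F i.1) (l - ν i.1) = 1 - p ⟨S, i⟩ := by
    by_cases hS : 1 < S.1.card
    · obtain ⟨l, hl⟩ := exists_sum_one_sub_cdf_eq_one hF ν hS
      obtain ⟨hne, θ, hθ, hmax, hprob⟩ := hyield S
      refine ⟨l, fun _ i => ?_⟩
      rw [hprob i, measureReal_argmaxEvent_of_isMaxOn hF ν hne l hl hθ hmax i.2]
      ring
    · exact ⟨0, fun h => absurd h hS⟩
  choose l hl using hlevel
  -- `δ` bounds from below the value of the distribution function at every threshold with `p x < 1`.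
  -- A point `c` with value below `δ` therefore lies strictly below all those of its group.
  obtain ⟨δ, hδ, hδp⟩ : ∃ δ : ℝ, 0 < δ ∧ ∀ x, p x < 1 → δ ≤ 1 - p x := by
    rcases {x | p x < 1}.eq_empty_or_nonempty with h | h
    · exact ⟨1, one_pos, fun x hx => absurd (show x ∈ {x | p x < 1} from hx) (by simp [h])⟩
    · obtain ⟨x₀, hx₀, hmin⟩ := Set.exists_min_image {x | p x < 1} (fun x => 1 - p x)
        (Set.toFinite _) h
      exact ⟨1 - p x₀, sub_pos.2 hx₀, hmin⟩
  have hbase (G : Fin K) : ∃ c, ∀ i, g i = G →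
      cdf (F i) c < δ ∧ ∀ t, cdf (F i) t = 0 → t ≤ c := by
    by_cases hG : ∃ i, g i = G
    · obtain ⟨i, rfl⟩ := hG
      obtain ⟨c, hc⟩ := (hF i).exists_cdf_lt_of_cdf_eq_zero_le hδ
      refine ⟨c, fun j hj => ?_⟩
      rwa [hFhat j, hj, ← hFhat i]
    · exact ⟨0, fun i hi => absurd ⟨i, hi⟩ hG⟩
  choose c hc using hbase
  -- If some product of `S` has probability one, the level is reset so that its threshold is the
  -- common point `c` of its group. This also provides a level for singletons.
  let lam (S : {S : Finset (Fin n) // S ∈ 𝒮}) : ℝ :=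
    if h : ∃ i : {i : Fin n // i ∈ S.1}, p ⟨S, i⟩ = 1 then ν h.choose.1 + c (g h.choose.1)
    else l S
  have hone (x : Pairs 𝒮) (hx : p x = 1) :
      lam x.assortment - ν x.product = c (g x.product) := by
    obtain ⟨S, i⟩ := x
    have h : ∃ i : {i : Fin n // i ∈ S.1}, p ⟨S, i⟩ = 1 := ⟨i, hx⟩
    have hi : h.choose = i := by
      by_contra hne
      have := hp.eq_zero_of_ne hx hne
      rw [h.choose_spec] at this
      exact one_ne_zero this
    simp only [lam, dif_pos h, hi, Pairs.product, Pairs.assortment]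
    ring
  have hlt (x : Pairs 𝒮) (hx : p x < 1) :
      cdf (F x.product) (lam x.assortment - ν x.product) = 1 - p x := by
    obtain ⟨S, j⟩ := x
    have hcard : 1 < S.1.card := lt_of_not_ge fun h =>
      hx.ne (hp.eq_one_of_card_le_one h j)
    by_cases h : ∃ i : {i : Fin n // i ∈ S.1}, p ⟨S, i⟩ = 1
    · obtain ⟨i, hi⟩ := h
      have hji : j ≠ i := by
        rintro rfl
        exact hx.ne hi
      have h₁ := hl S hcard i
      have h₂ := hl S hcard j
      rw [hi, sub_self] at h₁
      rw [hp.eq_zero_of_ne hi hji, sub_zero] at h₂ ⊢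
      -- The old threshold of `i` is a zero of its distribution function, hence at most `c`. So the
      -- reset only raises the level, and `j`, which has probability zero, keeps the value 1.
      have h₃ := (hc (g i.1) i.1 rfl).2 _ h₁
      have h₄ := hone ⟨S, i⟩ hi
      simp only [Pairs.product, Pairs.assortment] at h₄ ⊢
      refine le_antisymm (cdf_le_one _ _) (h₂ ▸ monotone_cdf _ ?_)
      linarith
    · simp only [lam, dif_neg h, Pairs.product, Pairs.assortment]
      exact hl S hcard j
  refine ⟨lam, ν, fun x y hxy => ?_⟩
  have hFxy : F x.product = F y.product := by rw [hFhat, hxy, ← hFhat]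
  constructor
  · intro hpxy
    have hx := hpxy.trans_le (hp.le_one y)
    refine lt_of_not_ge fun hle => ?_
    have h₁ := monotone_cdf (F x.product) hle
    rw [hlt x hx] at h₁
    rcases (hp.le_one y).eq_or_lt with hy | hy
    · rw [hone y hy, ← hxy] at h₁
      have := (hc _ x.product rfl).1
      linarith [hδp x hx]
    · rw [hFxy, hlt y hy] at h₁
      linarith
  · rintro ⟨hpxy, hp0⟩
    rcases (hp.le_one x).eq_or_lt with hx | hx
    · rw [hone x hx, hone y (hpxy ▸ hx), hxy]
    · have h₁ := hlt x hx
      refine (hF x.product).eq_of_cdf_eq ?_ ?_ ?_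
      · rw [h₁, hFxy, hlt y (hpxy ▸ hx), hpxy]
      · rw [h₁]; linarith
      · have := lt_of_le_of_ne (hp.1 x) hp0.symm
        rw [h₁]; linarith

theorem IsSeparating.isDistinctGroupedRepresentable (hp : IsChoiceCollection p)
    {lam : {S : Finset (Fin n) // S ∈ 𝒮} → ℝ} {ν : Fin n → ℝ} (h : IsSeparating g p lam ν) :
    IsDistinctGroupedRepresentable g p := by
  obtain ⟨M, hM⟩ : ∃ M : ℝ, ∀ x : Pairs 𝒮, |lam x.assortment - ν x.product| ≤ M := by
    obtain ⟨M, hM⟩ := (Set.finite_range fun x : Pairs 𝒮 =>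
      |lam x.assortment - ν x.product|).bddAbove
    exact ⟨M, fun x => hM (mem_range_self x)⟩
  -- `R` strictly exceeds all thresholds in absolute value. Translating group `G` by `3 * R * G`
  -- makes the intervals of radius `R` disjoint, so the laws differ; subtracting the shift from `ν`
  -- compensates.
  let R := |M| + 1
  have hR : 0 < R := by positivity
  let t (G : Fin K) : ℝ := 3 * R * G
  have hlaw (G : Fin K) : ∃ μ : Measure ℝ, IsAdmissibleMarginal μ ∧
      μ (Icc (t G - R) (t G + R))ᶜ = 0 ∧ ∀ x : {x : Pairs 𝒮 // g x.product = G},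
        cdf μ (lam x.1.assortment - ν x.1.product + t G) = 1 - p x.1 := by
    refine exists_admissible_with_tails
      (fun x : {x : Pairs 𝒮 // g x.product = G} =>
        lam x.1.assortment - ν x.1.product + t G) (fun x => p x.1) _ _ (by linarith) (fun x => ?_)
      (fun x => ⟨hp.1 _, hp.le_one _⟩) (fun x y hxy => ?_) (fun x y hxy hx => ?_)
    · have := abs_lt.1 (((hM x.1).trans (le_abs_self M)).trans_lt (lt_add_one |M|))
      constructor <;> simp only [R] <;> linarith
    · have := (h x.1 y.1 (x.2.trans y.2.symm)).1 hxy
      linarith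
    · simp only [(h x.1 y.1 (x.2.trans y.2.symm)).2 ⟨hxy, hx⟩]
  choose Fhat hadm hconc hcdf using hlaw
  have hval (x : Pairs 𝒮) : cdf (Fhat (g x.product))
      (lam x.assortment - (ν x.product - t (g x.product))) = 1 - p x := by
    rw [← hcdf (g x.product) ⟨x, rfl⟩]
    congr 1
    ring
  refine ⟨fun i => Fhat (g i), fun i => ν i - t (g i), fun i => hadm _,
    ⟨Fhat, fun G H hGH => ?_, fun i => rfl⟩, fun S => ?_⟩
  · by_contra hne
    wlog hlt : G < H generalizing G H
    · exact this H G hGH.symm (Ne.symm hne) (lt_of_le_of_ne (not_lt.1 hlt) (Ne.symm hne))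
    have := (hadm G).isProbabilityMeasure
    have hnull : Fhat G univ = 0 := by
      refine measure_mono_null (fun x _ => ?_)
        (measure_union_null (hconc G) (hGH ▸ hconc H))
      have : (G : ℝ) + 1 ≤ H := by exact_mod_cast hlt
      have : t G + 3 * R ≤ t H := by simp only [t]; nlinarith
      by_contra hx
      simp only [mem_union, not_or, mem_compl_iff, not_not, mem_Icc] at hx
      linarith [hx.1.2, hx.2.1]
    simp at hnull
  · have hS := hp.nonempty S
    have hsum : ∑ i ∈ S.1, (1 - cdf (Fhat (g i)) (lam S - (ν i - t (g i)))) = 1 := by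
      rw [← Finset.sum_coe_sort]
      refine (Finset.sum_congr rfl fun i _ => ?_).trans (hp.2 S)
      rw [hval ⟨S, i⟩]
      ring
    obtain ⟨θ, hθ, hmax⟩ := exists_isMaxOn_expectedMaxUtility (F := fun i => Fhat (g i))
      (fun i => hadm _) (fun i => ν i - t (g i)) hS (lam S) hsum
    refine ⟨hS, θ, hθ, hmax, fun i => ?_⟩
    rw [measureReal_argmaxEvent_of_isMaxOn (fun i => hadm _) _ hS (lam S) hsum hθ hmax i.2,
      hval ⟨S, i⟩]
    ring

theorem IsDistinctGroupedRepresentable.isGroupedRepresentable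
    (h : IsDistinctGroupedRepresentable g p) : IsGroupedRepresentable g p := by
  obtain ⟨F, ν, hF, ⟨Fhat, _, hFhat⟩, hy⟩ := h
  exact ⟨F, ν, hF, ⟨Fhat, hFhat⟩, hy⟩

end Characterization

/-! ### The linear program and its size -/

section Program

variable {n K : ℕ} {g : Fin n → Fin K} {𝒮 : Finset (Finset (Fin n))} {p : Pairs 𝒮 → ℝ}

theorem sum_gapCoeff_mul (x y : Pairs 𝒮) (a : TestVar 𝒮 → ℝ) :
    ∑ v, gapCoeff x y v * a v =
      (a (Sum.inl x.assortment) - a (Sum.inr (Sum.inl x.product))) -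
        (a (Sum.inl y.assortment) - a (Sum.inr (Sum.inl y.product))) := by
  simp only [gapCoeff, Pi.sub_apply, sub_mul, Finset.sum_sub_distrib, Pi.single_apply, ite_mul,
    one_mul, zero_mul, Finset.sum_ite_eq', Finset.mem_univ, if_true]

theorem sum_epsCoeff_mul (a : TestVar 𝒮 → ℝ) :
    ∑ v, epsCoeff 𝒮 v * a v = a (Sum.inr (Sum.inr ())) := by
  simp only [epsCoeff, Pi.single_apply, ite_mul, one_mul, zero_mul, Finset.sum_ite_eq',
    Finset.mem_univ, if_true]

theorem mem_feasible_testProgram_iff (a : TestVar 𝒮 → ℝ) :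
    a ∈ (testProgram g p).feasible ↔
      (∀ x y : Pairs 𝒮, g x.product = g y.product → p x < p y →
        a (Sum.inr (Sum.inr ())) ≤
          (a (Sum.inl x.assortment) - a (Sum.inr (Sum.inl x.product))) -
            (a (Sum.inl y.assortment) - a (Sum.inr (Sum.inl y.product)))) ∧
      ∀ x y : Pairs 𝒮, g x.product = g y.product → p x = p y → p x ≠ 0 →
        (a (Sum.inl x.assortment) - a (Sum.inr (Sum.inl x.product))) -
          (a (Sum.inl y.assortment) - a (Sum.inr (Sum.inl y.product))) = 0 := by
  simp only [LinearProgram.feasible, testProgram, Set.mem_ofPred_eq, Pi.sub_apply, sub_mul,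
    Finset.sum_sub_distrib, sum_gapCoeff_mul, sum_epsCoeff_mul, Subtype.forall, Prod.forall,
    and_imp, sub_nonneg]

/-- A supremum is positive exactly when some feasible `ε` is. For given thresholds the smallest gap
over the finitely many strict rows serves as `ε`; without such rows `ε` is unconstrained and 1 will
do. -/
theorem testProgram_value_pos_iff :
    0 < (testProgram g p).value ↔ ∃ lam ν, IsSeparating g p lam ν := by
  have hval : 0 < (testProgram g p).value ↔
      ∃ a ∈ (testProgram g p).feasible, 0 < a (Sum.inr (Sum.inr ())) := by
    simp only [LinearProgram.value, lt_iSup_iff, testProgram, sum_epsCoeff_mul, exists_prop,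
      EReal.coe_pos]
  rw [hval]
  constructor
  · rintro ⟨a, ha, hpos⟩
    rw [mem_feasible_testProgram_iff] at ha
    exact ⟨fun S => a (Sum.inl S), fun i => a (Sum.inr (Sum.inl i)), fun x y hxy =>
      ⟨fun h => sub_pos.1 (hpos.trans_le (ha.1 x y hxy h)),
        fun h => sub_eq_zero.1 (ha.2 x y hxy h.1 h.2)⟩⟩
  · rintro ⟨lam, ν, h⟩
    obtain ⟨e, he, hle⟩ : ∃ e : ℝ, 0 < e ∧ ∀ c : StrictRows g p,
        e ≤ (lam c.1.1.assortment - ν c.1.1.product) -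
          (lam c.1.2.assortment - ν c.1.2.product) := by
      rcases isEmpty_or_nonempty (StrictRows g p) with hemp | hne
      · exact ⟨1, one_pos, fun c => hemp.elim c⟩
      · obtain ⟨c, hc⟩ := Finite.exists_min fun c : StrictRows g p =>
          (lam c.1.1.assortment - ν c.1.1.product) -
            (lam c.1.2.assortment - ν c.1.2.product)
        exact ⟨_, sub_pos.2 ((h c.1.1 c.1.2 c.2.1).1 c.2.2), hc⟩
    refine ⟨Sum.elim lam (Sum.elim ν fun _ => e), ?_, he⟩
    rw [mem_feasible_testProgram_iff]
    exact ⟨fun x y hxy hlt => hle ⟨(x, y), hxy, hlt⟩,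
      fun x y hxy heq h0 => sub_eq_zero.2 ((h x y hxy).2 ⟨heq, h0⟩)⟩

theorem numVars_testProgram_le (hp : IsChoiceCollection p) (h𝒮 : 𝒮.Nonempty) :
    (testProgram g p).numVars ≤ 3 * (n * 𝒮.card) := by
  have hn : 1 ≤ n := by
    obtain ⟨S, hS⟩ := h𝒮
    obtain ⟨i, _⟩ := hp.nonempty ⟨S, hS⟩
    exact i.pos
  have hc : 1 ≤ 𝒮.card := h𝒮.card_pos
  have : (testProgram g p).numVars = 𝒮.card + (n + 1) := by
    simp [LinearProgram.numVars]
  rw [this]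
  have h₁ : 𝒮.card ≤ n * 𝒮.card := Nat.le_mul_of_pos_left _ hn
  have h₂ : n ≤ n * 𝒮.card := Nat.le_mul_of_pos_right _ hc
  lia

theorem card_pairs_le (𝒮 : Finset (Finset (Fin n))) : Nat.card (Pairs 𝒮) ≤ n * 𝒮.card := by
  have hinj : Function.Injective fun x : Pairs 𝒮 => (x.product, x.assortment) := by
    rintro ⟨S, i⟩ ⟨T, j⟩ h
    obtain ⟨hij, hST⟩ := Prod.mk.inj h
    obtain rfl : S = T := hST
    exact congrArg (Sigma.mk S) (Subtype.ext hij)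
  refine (Nat.card_le_card_of_injective _ hinj).trans_eq ?_
  simp

/-- Strict and tie rows are disjoint sets of ordered pairs, so together they inject into `Pairs 𝒮 ×
Pairs 𝒮` and no factor 2 arises. -/
theorem numConstraints_testProgram_le :
    (testProgram g p).numConstraints ≤ n ^ 2 * 𝒮.card ^ 2 := by
  have hinj : Function.Injective
      (Sum.elim Subtype.val Subtype.val : StrictRows g p ⊕ TieRows g p → Pairs 𝒮 × Pairs 𝒮) :=
    Subtype.val_injective.sumElim Subtype.val_injective fun c d h =>
      (h ▸ c.2.2).ne d.2.2.1
  calc (testProgram g p).numConstraints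
      = Nat.card (StrictRows g p ⊕ TieRows g p) := Nat.card_sum.symm
    _ ≤ Nat.card (Pairs 𝒮 × Pairs 𝒮) := Nat.card_le_card_of_injective _ hinj
    _ = Nat.card (Pairs 𝒮) * Nat.card (Pairs 𝒮) := Nat.card_prod _ _
    _ ≤ (n * 𝒮.card) * (n * 𝒮.card) := Nat.mul_le_mul (card_pairs_le 𝒮) (card_pairs_le 𝒮)
    _ = n ^ 2 * 𝒮.card ^ 2 := by ring

end Program

end ChoiceModel

theorem theorem5 {n K : ℕ} (g : Fin n → Fin K) (𝒮 : Finset (Finset (Fin n)))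
    (p : ChoiceModel.Pairs 𝒮 → ℝ) (hp : ChoiceModel.IsChoiceCollection p) :
    (ChoiceModel.IsGroupedRepresentable g p ↔
      ∃ (lam : {S : Finset (Fin n) // S ∈ 𝒮} → ℝ) (ν : Fin n → ℝ),
        ∀ x y : ChoiceModel.Pairs 𝒮, g x.product = g y.product →
          (p x < p y → lam x.assortment - ν x.product > lam y.assortment - ν y.product) ∧
          (p x = p y ∧ p x ≠ 0 →
            lam x.assortment - ν x.product = lam y.assortment - ν y.product)) ∧
    (ChoiceModel.IsDistinctGroupedRepresentable g p ↔
      ChoiceModel.IsGroupedRepresentable g p) ∧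
    (ChoiceModel.IsGroupedRepresentable g p ↔ 0 < (ChoiceModel.testProgram g p).value) ∧
    (𝒮.Nonempty → (ChoiceModel.testProgram g p).numVars ≤ 3 * (n * 𝒮.card)) ∧
    (ChoiceModel.testProgram g p).numConstraints ≤ n ^ 2 * 𝒮.card ^ 2 := by
  have hiff : ChoiceModel.IsGroupedRepresentable g p ↔
      ∃ lam ν, ChoiceModel.IsSeparating g p lam ν :=
    ⟨fun h => h.exists_isSeparating hp, fun ⟨_, _, h⟩ =>
      (h.isDistinctGroupedRepresentable hp).isGroupedRepresentable⟩
  refine ⟨hiff, ⟨fun h => h.isGroupedRepresentable, fun h => ?_⟩,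
    hiff.trans ChoiceModel.testProgram_value_pos_iff.symm,
    ChoiceModel.numVars_testProgram_le hp, ChoiceModel.numConstraints_testProgram_le⟩
  obtain ⟨_, _, h⟩ := h.exists_isSeparating hp
  exact h.isDistinctGroupedRepresentable hp
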